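/- Work in the affine plane $\mathbb C^2$. For $p_i=(x_i,y_i)\in\mathbb C^2$ put $\mathrm{Area}(p_1p_2p_3)=\frac12\det\begin{pmatrix}1&1&1\\x_1&x_2&x_3\\y_1&y_2&y_3\end{pmatrix}$. A \emph{polygon} is a cyclically ordered set $(s_1,\dots,s_m)$ of $m\ge 3$ distinct points of $\mathbb C^2$; its edges are the ordered pairs $(s_i,s_{i+1})$, indices mod $m$. A \emph{triangle} is a polygon with three vertices (so it is oriented). A polygon is \emph{totally degenerate} if all its vertices lie on one complex line. To a finite family of polygons one associates the 2-complex that has one 2-cell for each polygon, with vertices labelled by the points, in which the edge $(v,w)$ of one polygon is glued to the edge $(w,v)$ of another. A \emph{generalized dissection} $\mathcal D$ of a polygon $P$ consists of a finite set $\mathcal A$ of triangles, none of them totally degenerate, and a finite set $\mathcal C$ of totally degenerate polygons (the constraints), such that every vertex of a constraint is a vertex of some triangle in $\mathcal A$, any two distinct constraints share at most one vertex, and the 2-complex associated to $\mathcal A\cup\mathcal C$ is an oriented disk with oriented boundary $P$. A (possibly degenerate) \emph{parallelogram} is a $4$-tuple $(p,q,r,s)$ of points, up to cyclic rotation, with $p+r=q+s$;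 its area is $\mathrm{Area}(pqr)+\mathrm{Area}(prs)$. If $P=(p,q,r,s)$ is a polygon and a parallelogram, a \emph{deformation} of $\mathcal D$ is a map $\rho$ from the set of vertices of $\mathcal D$ to $\mathbb C^2$ such that for each constraint $C\in\mathcal C$ the points $\rho(v)$, $v\in C$, lie on one complex line, and $\rho(p)+\rho(r)=\rho(q)+\rho(s)$. (No non-degeneracy or injectivity is required of $\rho$.) \textbf{Corollary.} Let $\mathcal D$ be a generalized dissection of a parallelogram $P=(p,q,r,s)$ with four distinct vertices, let $\Delta_1,\dots,\Delta_n$ be its triangles and $a_1,\dots,a_n$ their areas. Then there are a polynomial $f\in\mathbb Z[A_1,\dots,A_n]$ and an integer $e\ge 0$ such that $$f(a_1,\dots,a_n)=\tfrac12\,\mathrm{Area}(P)^e,$$ and such that moreover, with the same $f$ and $e$, for every deformation $\rho$ of $\mathcal D$, $$f\bigl(\mathrm{Area}(\rho(\Delta_1)),\dots,\mathrm{Area}(\rho(\Delta_n))\bigr)=\tfrac12\,\mathrm{Area}(\rho(P))^e .$$ -/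

import Mathlib

/-- The affine plane `ℂ²`. -/
abbrev Plane : Type := ℂ × ℂ

/-- `(v, w)` is an edge of the cyclically ordered set `s`: `w` comes directly after `v`, i.e. `s`
can be written, up to rotation, as `v, w, …`. -/
def IsEdge {α : Type*} (s : Cycle α) (v w : α) : Prop :=
  ∃ l : List α, s = ((v :: w :: l : List α) : Cycle α)

/-- A polygon: a cyclically ordered set of at least three distinct points of `ℂ²`. -/
def IsPolygon (s : Cycle Plane) : Prop :=
  s.Nodup ∧ 3 ≤ s.length

/-- An (oriented) triangle: a polygon with three vertices. -/
def IsTriangle (s : Cycle Plane) : Prop :=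
  s.Nodup ∧ s.length = 3

/-- All the points of `s` lie on one complex line. -/
def IsTotallyDegenerate (s : Cycle Plane) : Prop :=
  Collinear ℂ {v : Plane | v ∈ s}

/-- Four cyclically ordered points `p, q, r, s`, possibly degenerate, with `p + r = q + s`. -/
def IsParallelogram (b : Cycle Plane) : Prop :=
  ∃ p q r s : Plane, b = (([p, q, r, s] : List Plane) : Cycle Plane) ∧ p + r = q + s

/-! ### Areas -/

/-- The area of an ordered triple of points of `ℂ²`. -/
noncomputable def triangleArea (a b c : Plane) : ℂ :=
  1 / 2 * Matrix.det !![1, 1, 1; a.1, b.1, c.1; a.2, b.2, c.2]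

/-- The sum of the areas of the triples `0, v, w` over the edges `(v, w)` of the closed polygonal
path `l`. -/
noncomputable def listArea (l : List Plane) : ℂ :=
  (List.zipWith (triangleArea 0) l (l.rotate 1)).sum

theorem listArea_rotate (l : List Plane) (n : ℕ) : listArea (l.rotate n) = listArea l := by
  unfold listArea
  rw [List.rotate_rotate, Nat.add_comm, ← List.rotate_rotate,
    ← List.zipWith_rotate_distrib _ _ _ _ (by simp)]
  exact (List.rotate_perm _ _).sum_eq

/-- The signed area of a closed polygonal path in `ℂ²`. -/
noncomputable def area (s : Cycle Plane) : ℂ :=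
  Quotient.liftOn s listArea (by
    rintro l _ ⟨n, rfl⟩
    exact (listArea_rotate l n).symm)

/-- For a triangle, `area` is the usual determinant. -/
theorem area_triangle (a b c : Plane) :
    area (([a, b, c] : List Plane) : Cycle Plane) = triangleArea a b c := by
  change listArea [a, b, c] = _
  simp [listArea, triangleArea, Matrix.det_fin_three]
  ring

/-- For a parallelogram `p, q, r, s`, `area` is the determinant of the sides at `p`. -/
theorem area_parallelogram (p q r s : Plane) (h : p + r = q + s) :
    area (([p, q, r, s] : List Plane) : Cycle Plane) =
      (q.1 - p.1) * (s.2 - p.2) - (s.1 - p.1) * (q.2 - p.2) := by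
  have hr : r = q + s - p := by rw [← h]; abel
  subst hr
  change listArea [p, q, q + s - p, s] = _
  simp [listArea, triangleArea, Matrix.det_fin_three]
  ring

/-! ### The 2-complex of a family of polygons -/

/-- The vertex set used to realize complexes: a vertex for every point of `ℂ²` and a centre for
every polygon. -/
abbrev ConeVertex : Type := Plane ⊕ Cycle Plane

open Classical in
/-- The standard basis vector at a vertex. -/
noncomputable def basisPoint (x : ConeVertex) : ConeVertex → ℝ :=
  Pi.single x 1

/-- The geometric realization of the 2-complex of a family `F` of polygons. Each abstract polygon is
realized as the cone, from a centre of its own, over its boundary circle; the vertices are labelled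
by the points, so that the edge `(v, w)` of one polygon is glued to the edge `(w, v)` of another. -/
def realization (F : Finset (Cycle Plane)) : Set (ConeVertex → ℝ) :=
  {x | ∃ P ∈ F, ∃ v w : Plane, IsEdge P v w ∧
    x ∈ convexHull ℝ {basisPoint (Sum.inl v), basisPoint (Sum.inl w), basisPoint (Sum.inr P)}}

/-- The closed curve formed by the edges of the polygon `b`, in the same space. -/
def boundaryRealization (b : Cycle Plane) : Set (ConeVertex → ℝ) :=
  {x | ∃ v w : Plane, IsEdge b v w ∧
    x ∈ convexHull ℝ {basisPoint (Sum.inl v), basisPoint (Sum.inl w)}}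

/-- The 2-complex of the family `F` is an oriented disk with boundary `b`. -/
structure IsOrientedDisk (F : Finset (Cycle Plane)) (b : Cycle Plane) : Prop where
  /-- An oriented edge belongs to at most one polygon, so that polygons with a common edge
  traverse it in opposite directions. -/
  edge_unique : ∀ P ∈ F, ∀ Q ∈ F, ∀ v w : Plane, IsEdge P v w → IsEdge Q v w → P = Q
  /-- The edges of `b` are, as oriented edges, exactly the edges that are not glued to another. -/
  edge_boundary : ∀ v w : Plane,
    IsEdge b v w ↔ (∃ P ∈ F, IsEdge P v w) ∧ ¬ ∃ Q ∈ F, IsEdge Q w v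
  /-- The complex is a closed disk whose boundary circle is the curve `b`. -/
  homeomorph_disk : ∃ h : realization F ≃ₜ Metric.closedBall (0 : EuclideanSpace ℝ (Fin 2)) 1,
    ∀ x : realization F,
      (x : ConeVertex → ℝ) ∈ boundaryRealization b ↔ ‖(h x : EuclideanSpace ℝ (Fin 2))‖ = 1

/-! ### Generalized dissections and their deformations -/

open Classical in
/-- A generalized dissection of the polygon `b`: finitely many non-degenerate triangles and finitely
many collinearity constraints whose 2-complex is an oriented disk with boundary `b`. -/
structure GeneralizedDissection (b : Cycle Plane) where
  triangles : Finset (Cycle Plane)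
  constraints : Finset (Cycle Plane)
  isTriangle : ∀ t ∈ triangles, IsTriangle t ∧ ¬ IsTotallyDegenerate t
  isConstraint : ∀ c ∈ constraints, IsPolygon c ∧ IsTotallyDegenerate c ∧
    ∀ v ∈ c, ∃ t ∈ triangles, v ∈ t
  constraints_inter : ∀ c ∈ constraints, ∀ c' ∈ constraints, c ≠ c' →
    ∀ v w : Plane, v ∈ c → v ∈ c' → w ∈ c → w ∈ c' → v = w
  isOrientedDisk : IsOrientedDisk (triangles ∪ constraints) b

/-- `ρ` is a deformation of `D` (a drawing of the constrained triangulation of `D`): it moves the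
vertices of `D` so that the vertices of every constraint remain collinear and the boundary remains
a (possibly degenerate) parallelogram. Only the values of `ρ` at the vertices of `D` matter. -/
structure GeneralizedDissection.IsDeformation {b : Cycle Plane} (D : GeneralizedDissection b)
    (ρ : Plane → Plane) : Prop where
  constraint : ∀ c ∈ D.constraints, IsTotallyDegenerate (c.map ρ)
  boundary : IsParallelogram (b.map ρ)

/-! The proof is Monsky's argument, carried out for all deformations at once. Let `S` be the ring of
all complex functions on the set of deformations and `A` its subring generated over the integers by
the areas of the triangles. The constraints have area zero, so the boundary area is the sum σ of the
generators (`sum_area_map`). The claim is that 2 divides a power of σ in `A`: such an identity of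
functions gives one `f` and one `e` valid at every deformation. Otherwise some prime of `A` contains
2 but not σ, and `exists_valuationSubring_of_mul_ne_pow` yields a place of a residue field of `S`
with all areas of value at most 1, σ of value 1 and 2 of value below 1. Since `S` also contains the
vertex coordinates, the complex is drawn over that valued field. A Sperner parity count
(`sum_cycleSum_eq_cycleSum_boundary`, `exists_three_colors_of_cycleSum_ne_zero`) finds a
three-coloured cell, hence three of its vertices with determinant of value at least 1. In a triangle
this determinant is twice an area up to sign, of value below 1; in a constraint it is 0. Both are
impossible. -/

/-! ### Sums over the edges of a cycle -/

section CycleSum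

variable {α M : Type*}

/-- The sum of `g v w` over the edges `(v, w)` of a cycle. -/
def cycleSum [AddCommMonoid M] (g : α → α → M) (s : Cycle α) : M :=
  Quotient.liftOn s (fun l => (List.zipWith g l (l.rotate 1)).sum) (by
    rintro l _ ⟨n, rfl⟩
    rw [List.rotate_rotate, Nat.add_comm, ← List.rotate_rotate,
      ← List.zipWith_rotate_distrib _ _ _ _ (by simp)]
    exact (List.rotate_perm _ _).sum_eq.symm)

theorem cycleSum_coe [AddCommMonoid M] (g : α → α → M) (l : List α) :
    cycleSum g (l : Cycle α) = (List.zipWith g l (l.rotate 1)).sum := rfl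

/-- The length bound excludes a singleton, whose zip with its rotation is a loop that `IsEdge` does
not count. -/
theorem mem_zip_rotate_one_iff_isEdge {l : List α} (hl : 2 ≤ l.length) (v w : α) :
    (v, w) ∈ l.zip (l.rotate 1) ↔ IsEdge (l : Cycle α) v w := by
  have hrot (n : ℕ) : (l.zip (l.rotate 1)).rotate n = (l.rotate n).zip ((l.rotate n).rotate 1) := by
    rw [List.rotate_rotate, Nat.add_comm n, ← List.rotate_rotate]
    exact List.zipWith_rotate_distrib _ _ _ _ (by simp)
  constructor
  · intro h
    obtain ⟨i, hi, h⟩ := List.mem_iff_getElem.1 h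
    have h1 : ((l.zip (l.rotate 1)).rotate i).head? = some (v, w) := by
      rw [List.head?_rotate hi, List.getElem?_eq_getElem hi, h]
    rw [hrot] at h1
    obtain ⟨a, b, t, hm⟩ : ∃ a b t, l.rotate i = a :: b :: t := by
      have : 2 ≤ (l.rotate i).length := by simpa using hl
      match l.rotate i, this with
      | a :: b :: t, _ => exact ⟨a, b, t, rfl⟩
    rw [hm, List.zip, List.zipWith_rotate_one] at h1
    simp only [List.head?_cons, Option.some.injEq, Prod.mk.injEq] at h1
    refine ⟨t, ?_⟩
    rw [← h1.1, ← h1.2, ← hm]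
    exact Cycle.coe_eq_coe.2 ⟨i, rfl⟩
  · rintro ⟨t, ht⟩
    obtain ⟨n, hn⟩ := Cycle.coe_eq_coe.1 ht
    rw [← List.mem_rotate (n := n), hrot, hn, List.zip, List.zipWith_rotate_one]
    simp

theorem IsEdge.ne {s : Cycle α} (hs : s.Nodup) {v w : α} (h : IsEdge s v w) : v ≠ w := by
  obtain ⟨l, rfl⟩ := h
  rw [Cycle.nodup_coe_iff] at hs
  rintro rfl
  simp at hs

/-- The edges of a cycle without repetitions form a finite set, over which `cycleSum` sums. -/
theorem exists_edge_finset {s : Cycle α} (hs : s.Nodup) (hlen : 2 ≤ s.length) :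
    ∃ E : Finset (α × α), (∀ v w, (v, w) ∈ E ↔ IsEdge s v w) ∧
      ∀ (M : Type) [AddCommMonoid M] (g : α → α → M), cycleSum g s = ∑ e ∈ E, g e.1 e.2 := by
  classical
  induction s using Quotient.inductionOn with
  | h l =>
    have hs' : l.Nodup := hs
    have hlen' : 2 ≤ l.length := hlen
    refine ⟨(l.zip (l.rotate 1)).toFinset, fun v w => ?_, fun M _ g => ?_⟩
    · rw [List.mem_toFinset, mem_zip_rotate_one_iff_isEdge hlen']
      rfl
    · have hnd : (l.zip (l.rotate 1)).Nodup := by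
        refine List.Nodup.of_map Prod.fst ?_
        rwa [List.map_fst_zip (by simp)]
      rw [List.sum_toFinset _ hnd]
      rw [List.map_zip_eq_zipWith]
      rfl

/-- A telescoping sum over a cycle vanishes. -/
theorem cycleSum_eq_zero_of_eq_sub [AddCommGroup M] {g : α → α → M} {s : Cycle α} (χ : α → M)
    (h : ∀ v ∈ s, ∀ w ∈ s, g v w = χ w - χ v) : cycleSum g s = 0 := by
  induction s using Quotient.inductionOn with
  | h l =>
    have h' : ∀ v ∈ l, ∀ w ∈ l, g v w = χ w - χ v := h
    have hz : List.zipWith g l (l.rotate 1) =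
        List.zipWith (fun v w => χ w - χ v) l (l.rotate 1) := by
      refine List.ext_getElem (by simp) fun i h1 h2 => ?_
      simp only [List.getElem_zipWith]
      exact h' _ (List.getElem_mem _) _ (List.mem_rotate.1 (List.getElem_mem _))
    have hsum (l₁ : List α) : ∀ l₂ : List α, l₁.length = l₂.length →
        (List.zipWith (fun v w => χ w - χ v) l₁ l₂).sum = (l₂.map χ).sum - (l₁.map χ).sum := by
      induction l₁ with
      | nil => intro l₂ h; simp [List.length_eq_zero_iff.1 h.symm]
      | cons a l₁ ih =>
        rintro (_ | ⟨b, l₂⟩) h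
        · simp at h
        · simp only [List.zipWith_cons_cons, List.sum_cons, List.map_cons]
          rw [ih l₂ (by simpa using h)]
          abel
    change (List.zipWith g l (l.rotate 1)).sum = 0
    rw [hz, hsum _ _ (by simp), ((List.rotate_perm l 1).map χ).sum_eq, sub_self]

/-- The edge sums of an antisymmetric function over a family of cycles glued along opposite edges
add up to the edge sum over the boundary. -/
theorem sum_cycleSum_eq_cycleSum_boundary {M : Type} [AddCommGroup M] {F : Finset (Cycle α)}
    {b : Cycle α} (hF : ∀ P ∈ F, P.Nodup ∧ 2 ≤ P.length) (hb : b.Nodup ∧ 2 ≤ b.length)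
    (edge_unique : ∀ P ∈ F, ∀ Q ∈ F, ∀ v w : α, IsEdge P v w → IsEdge Q v w → P = Q)
    (edge_boundary : ∀ v w : α,
      IsEdge b v w ↔ (∃ P ∈ F, IsEdge P v w) ∧ ¬ ∃ Q ∈ F, IsEdge Q w v)
    {g : α → α → M} (hg : ∀ v w, g v w + g w v = 0) :
    ∑ P ∈ F, cycleSum g P = cycleSum g b := by
  classical
  choose! E hE hsum using fun P : Cycle α => fun h : P.Nodup ∧ 2 ≤ P.length =>
    exists_edge_finset h.1 h.2
  have hmem (v w : α) : (v, w) ∈ F.biUnion E ↔ ∃ P ∈ F, IsEdge P v w := by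
    rw [Finset.mem_biUnion]
    exact exists_congr fun P => and_congr_right fun hP => hE P (hF P hP) v w
  have hdisj : (F : Set (Cycle α)).PairwiseDisjoint E := by
    intro P hP Q hQ hPQ
    refine Finset.disjoint_left.2 fun e he he' => hPQ ?_
    exact edge_unique P hP Q hQ e.1 e.2 ((hE P (hF P hP) _ _).1 he) ((hE Q (hF Q hQ) _ _).1 he')
  rw [Finset.sum_congr rfl fun P hP => hsum P (hF P hP) M g, ← Finset.sum_biUnion hdisj,
    hsum b hb M g, ← Finset.sum_filter_add_sum_filter_not _ fun e => e.swap ∈ F.biUnion E]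
  -- Glued edges cancel in pairs under reversal, which fixes no edge because endpoints are distinct.
  have h0 : ∑ e ∈ F.biUnion E with e.swap ∈ F.biUnion E, g e.1 e.2 = 0 := by
    refine Finset.sum_involution (fun e _ => e.swap) (fun e _ => hg _ _) (fun e he _ h => ?_)
      (fun e he => ?_) (fun e _ => e.swap_swap)
    · obtain ⟨P, hP, hPe⟩ := (hmem e.1 e.2).1 (Finset.mem_filter.1 he).1
      exact hPe.ne (hF P hP).1 (congrArg Prod.snd h)
    · rw [Finset.mem_filter] at he ⊢
      exact ⟨he.2, by simpa using he.1⟩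
  rw [h0, zero_add]
  refine Finset.sum_congr (Finset.ext fun ⟨v, w⟩ => ?_) fun _ _ => rfl
  rw [Finset.mem_filter, hE b hb, edge_boundary, hmem, Prod.swap_prod_mk, hmem]

/-- A cycle with an odd number of edges between the colours `0` and `1` has all three colours. -/
theorem exists_three_colors_of_cycleSum_ne_zero {c : α → Fin 3} {s : Cycle α}
    (h : cycleSum (fun v w => if c v = 0 ∧ c w = 1 ∨ c v = 1 ∧ c w = 0 then (1 : ZMod 2) else 0) s
      ≠ 0) : ∀ k, ∃ v ∈ s, c v = k := by
  intro k
  by_contra! hk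
  refine h ?_
  -- With only colours 0 and 1, the indicator of a colour change is a coboundary mod 2; if 0 or 1 is
  -- missing, every term is zero.
  obtain rfl | hk2 := eq_or_ne k 2
  · refine cycleSum_eq_zero_of_eq_sub (fun v => if c v = 0 then 1 else 0) fun v hv w hw => ?_
    have h1 := hk v hv
    have h2 := hk w hw
    generalize c v = x at *
    generalize c w = y at *
    revert x y
    decide
  · refine cycleSum_eq_zero_of_eq_sub (fun _ => 0) fun v hv w hw => ?_
    have h1 := hk v hv
    have h2 := hk w hw
    generalize c v = x at *
    generalize c w = y at *
    clear hk h
    revert k x y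
    decide

end CycleSum

/-! ### Places separating an element from a radical -/

/-- If no multiple of `x` in `A` is a power of `y`, then a place of some residue field of an
extension `S` of `A` is finite on `A`, nonzero at `y`, and zero at `x`. -/
theorem exists_valuationSubring_of_mul_ne_pow {A S : Type} [CommRing A] [CommRing S]
    (i : A →+* S) (hi : Function.Injective i) (x y : A) (h : ∀ (a : A) (e : ℕ), x * a ≠ y ^ e) :
    ∃ (K : Type) (_ : Field K) (V : ValuationSubring K) (φ : S →+* K),
      (∀ a, V.valuation (φ (i a)) ≤ 1) ∧ V.valuation (φ (i x)) < 1 ∧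
        V.valuation (φ (i y)) = 1 := by
  have hy : y ∉ (Ideal.span {x}).radical := by
    rintro ⟨e, he⟩
    obtain ⟨a, ha⟩ := Ideal.mem_span_singleton'.1 he
    exact h a e (by rw [mul_comm, ha])
  rw [Ideal.radical_eq_sInf, Ideal.mem_sInf] at hy
  push Not at hy
  obtain ⟨p, ⟨hxp, hp⟩, hyp⟩ := hy
  -- The prime `p` itself need not be contracted from `S`, but a minimal prime below it is, since
  -- `i` is injective.
  obtain ⟨q, hq, hqp⟩ := Ideal.exists_minimalPrimes_le (bot_le : ⊥ ≤ p)
  obtain ⟨Q, hQ, rfl⟩ := Ideal.exists_comap_eq_of_mem_minimalPrimes_of_injective hi q hq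
  let φ : S →+* FractionRing (S ⧸ Q) :=
    (algebraMap (S ⧸ Q) (FractionRing (S ⧸ Q))).comp (Ideal.Quotient.mk Q)
  have hφ (s : S) : φ s = 0 ↔ s ∈ Q := by
    rw [← Ideal.Quotient.eq_zero_iff_mem]
    exact map_eq_zero_iff _ (IsFractionRing.injective (S ⧸ Q) _)
  have hunit (a : p.primeCompl) : IsUnit ((φ.comp i) a) := by
    rw [isUnit_iff_ne_zero, RingHom.comp_apply, Ne, hφ]
    exact fun ha => a.2 (hqp ha)
  let ψ : Localization.AtPrime p →+* FractionRing (S ⧸ Q) := IsLocalization.lift hunit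
  have hψ (a : A) : ψ (algebraMap A _ a) = φ (i a) := IsLocalization.lift_eq hunit a
  -- The valuation ring dominates the localization at `p`, so value 1 on its image means being a
  -- unit there, that is, lying outside `p` for elements of `A`.
  obtain ⟨V, hV, hloc⟩ := IsLocalRing.exists_factor_valuationRing ψ
  have hmem (z) : V.valuation (ψ z) ≤ 1 := (V.valuation_le_one_iff _).2 (hV z)
  have hone (z) : V.valuation (ψ z) = 1 ↔ IsUnit z := by
    rw [← isUnit_map_iff (ψ.codRestrict V.toSubring hV)]
    exact (V.valuation_eq_one_iff ⟨ψ z, hV z⟩).symm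
  refine ⟨FractionRing (S ⧸ Q), inferInstance, V, φ, fun a => ?_, ?_, ?_⟩
  · rw [← hψ]; exact hmem _
  · refine lt_of_le_of_ne (by rw [← hψ]; exact hmem _) ?_
    rw [← hψ, Ne, hone, IsLocalization.AtPrime.isUnit_to_map_iff _ p]
    exact fun hx => hx (hxp (Ideal.mem_span_singleton_self x))
  · rw [← hψ, hone, IsLocalization.AtPrime.isUnit_to_map_iff _ p]
    exact hyp

/-! ### Monsky's colouring over a valued field -/

section Monsky

variable {K : Type*} [Field K]

open Classical in
/-- Monsky's colouring of the plane over a valued field. -/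
noncomputable def monskyColor (V : ValuationSubring K) (x y : K) : Fin 3 :=
  if V.valuation x < 1 ∧ V.valuation y < 1 then 0
  else if V.valuation y ≤ V.valuation x then 1 else 2

/-- Three points of different colours span a triangle whose determinant has value at least `1`. -/
theorem one_le_valuation_det_of_monskyColor (V : ValuationSubring K) {x y : Fin 3 → K}
    (h : ∀ k, monskyColor V (x k) (y k) = k) :
    1 ≤ V.valuation ((x 1 - x 0) * (y 2 - y 0) - (x 2 - x 0) * (y 1 - y 0)) := by
  have h0 : V.valuation (x 0) < 1 ∧ V.valuation (y 0) < 1 := by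
    have := h 0
    unfold monskyColor at this
    split_ifs at this with h1 h2
    exacts [h1, absurd this (by decide), absurd this (by decide)]
  have h1 : 1 ≤ V.valuation (x 1) ∧ V.valuation (y 1) ≤ V.valuation (x 1) := by
    have := h 1
    unfold monskyColor at this
    split_ifs at this with h1 h2
    exacts [absurd this (by decide),
      ⟨not_lt.1 fun h3 => h1 ⟨h3, h2.trans_lt h3⟩, h2⟩, absurd this (by decide)]
  have h2 : 1 ≤ V.valuation (y 2) ∧ V.valuation (x 2) < V.valuation (y 2) := by
    have := h 2
    unfold monskyColor at this
    split_ifs at this with h1 h2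
    exacts [absurd this (by decide), absurd this (by decide),
      ⟨not_lt.1 fun h3 => h1 ⟨(not_le.1 h2).trans h3, h3⟩, not_le.1 h2⟩]
  have e1 : V.valuation (x 1 - x 0) = V.valuation (x 1) :=
    Valuation.map_sub_eq_of_lt_left _ (h0.1.trans_le h1.1)
  have e2 : V.valuation (y 2 - y 0) = V.valuation (y 2) :=
    Valuation.map_sub_eq_of_lt_left _ (h0.2.trans_le h2.1)
  have e3 : V.valuation (x 2 - x 0) < V.valuation (y 2) :=
    Valuation.map_sub_lt _ h2.2 (h0.1.trans_le h2.1)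
  have e4 : V.valuation (y 1 - y 0) ≤ V.valuation (x 1) :=
    Valuation.map_sub_le _ h1.2 (h0.2.le.trans h1.1)
  -- By the ultrametric inequality, one product strictly dominates the other and alone determines
  -- the value.
  have hlt : V.valuation ((x 2 - x 0) * (y 1 - y 0)) <
      V.valuation ((x 1 - x 0) * (y 2 - y 0)) := by
    rw [map_mul, map_mul, e1, e2, mul_comm (V.valuation (x 1))]
    exact mul_lt_mul_of_lt_of_le_of_nonneg_of_pos e3 e4 zero_le (zero_lt_one.trans_le h1.1)
  rw [Valuation.map_sub_eq_of_lt_left _ hlt, map_mul, e1, e2]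
  exact one_le_mul h1.1 h2.1

end Monsky

/-- The determinant of the triangle with vertices `u, v, w` in the coordinates `x, y`. -/
def coordDet {α K : Type*} [CommRing K] (x y : α → K) (u v w : α) : K :=
  (x v - x u) * (y w - y u) - (x w - x u) * (y v - y u)

/-- **Monsky's theorem** for a complex of cycles bounded by a parallelogram of unit area over a
valued field: some cycle contains a triangle whose determinant has value at least `1`. -/
theorem exists_one_le_valuation_coordDet {α : Type*} {K : Type*} [Field K] (V : ValuationSubring K)
    (x y : α → K) {p q r s : α} {F : Finset (Cycle α)}
    (hF : ∀ P ∈ F, P.Nodup ∧ 2 ≤ P.length) (hb : ([p, q, r, s] : Cycle α).Nodup)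
    (edge_unique : ∀ P ∈ F, ∀ Q ∈ F, ∀ v w : α, IsEdge P v w → IsEdge Q v w → P = Q)
    (edge_boundary : ∀ v w : α, IsEdge ([p, q, r, s] : Cycle α) v w ↔
      (∃ P ∈ F, IsEdge P v w) ∧ ¬ ∃ Q ∈ F, IsEdge Q w v)
    (hx : x p + x r = x q + x s) (hy : y p + y r = y q + y s)
    (hdet : V.valuation (coordDet x y p q s) = 1) :
    ∃ P ∈ F, ∃ u v w, u ∈ P ∧ v ∈ P ∧ w ∈ P ∧ u ≠ v ∧ v ≠ w ∧ u ≠ w ∧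
      1 ≤ V.valuation (coordDet x y u v w) := by
  have hd : coordDet x y p q s ≠ 0 := by
    intro h
    rw [h, map_zero] at hdet
    exact zero_ne_one hdet
  have hxr : x r = x q + x s - x p := by rw [← hx]; ring
  have hyr : y r = y q + y s - y p := by rw [← hy]; ring
  -- Cramer's rule: affine coordinates that carry `p, q, r, s` to the corners of the unit square.
  let X : α → K := fun v => coordDet x y p v s / coordDet x y p q s
  let Y : α → K := fun v => coordDet x y p q v / coordDet x y p q s
  let c : α → Fin 3 := fun v => monskyColor V (X v) (Y v)
  have hXp : X p = 0 := by simp only [X, div_eq_zero_iff]; left; unfold coordDet; ring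
  have hYp : Y p = 0 := by simp only [Y, div_eq_zero_iff]; left; unfold coordDet; ring
  have hXq : X q = 1 := div_self hd
  have hYq : Y q = 0 := by simp only [Y, div_eq_zero_iff]; left; unfold coordDet; ring
  have hXr : X r = 1 := by
    simp only [X, div_eq_one_iff_eq hd]; unfold coordDet; rw [hxr, hyr]; ring
  have hYr : Y r = 1 := by
    simp only [Y, div_eq_one_iff_eq hd]; unfold coordDet; rw [hxr, hyr]; ring
  have hXs : X s = 0 := by simp only [X, div_eq_zero_iff]; left; unfold coordDet; ring
  have hYs : Y s = 1 := div_self hd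
  have hcp : c p = 0 := by simp [c, monskyColor, hXp, hYp]
  have hcq : c q = 1 := by simp [c, monskyColor, hXq, hYq]
  have hcr : c r = 1 := by simp [c, monskyColor, hXr, hYr]
  have hcs : c s = 2 := by simp [c, monskyColor, hXs, hYs]
  have hsum := sum_cycleSum_eq_cycleSum_boundary hF ⟨hb, by simp⟩ edge_unique edge_boundary
    (g := fun v w => if c v = 0 ∧ c w = 1 ∨ c v = 1 ∧ c w = 0 then (1 : ZMod 2) else 0) (by
      intro v w
      generalize c v = i
      generalize c w = j
      revert i j
      decide)
  -- The corners have colours 0, 1, 1, 2, so `(p, q)` is the only boundary edge between 0 and 1.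
  have hone : cycleSum (fun v w => if c v = 0 ∧ c w = 1 ∨ c v = 1 ∧ c w = 0 then (1 : ZMod 2)
      else 0) ([p, q, r, s] : Cycle α) = 1 := by
    simp [cycleSum_coe, hcp, hcq, hcr, hcs]
  rw [hone] at hsum
  obtain ⟨P, hP, hne⟩ := Finset.exists_ne_zero_of_sum_ne_zero (hsum.trans_ne one_ne_zero)
  choose u huP huc using exists_three_colors_of_cycleSum_ne_zero hne
  have hne {i j : Fin 3} (h : i ≠ j) : u i ≠ u j := fun e => h (by rw [← huc i, ← huc j, e])
  refine ⟨P, hP, u 0, u 1, u 2, huP 0, huP 1, huP 2, hne (by decide), hne (by decide),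
    hne (by decide), ?_⟩
  have h := one_le_valuation_det_of_monskyColor V (x := X ∘ u) (y := Y ∘ u) huc
  -- The affine change divides determinants by that of `p, q, s`, which has value 1.
  have e : (X (u 1) - X (u 0)) * (Y (u 2) - Y (u 0)) - (X (u 2) - X (u 0)) * (Y (u 1) - Y (u 0)) =
      coordDet x y (u 0) (u 1) (u 2) / coordDet x y p q s := by
    simp only [X, Y]
    field_simp
    unfold coordDet
    ring
  simp only [Function.comp_apply] at h
  rwa [e, map_div₀, hdet, div_one] at h

/-! ### Areas of polygons and of their images -/

theorem two_mul_triangleArea (a b c : Plane) :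
    2 * triangleArea a b c = (b.1 - a.1) * (c.2 - a.2) - (c.1 - a.1) * (b.2 - a.2) := by
  simp only [triangleArea, Matrix.det_fin_three, Matrix.of_apply, Matrix.cons_val]
  ring

theorem triangleArea_eq_zero_of_collinear {S : Set Plane} (hS : Collinear ℂ S) {a b c : Plane}
    (ha : a ∈ S) (hb : b ∈ S) (hc : c ∈ S) : triangleArea a b c = 0 := by
  obtain ⟨d, hd⟩ := (collinear_iff_of_mem ha).1 hS
  obtain ⟨m, rfl⟩ := hd b hb
  obtain ⟨n, rfl⟩ := hd c hc
  have h := two_mul_triangleArea a (m • d +ᵥ a) (n • d +ᵥ a)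
  simp only [vadd_eq_add, Prod.fst_add, Prod.snd_add, Prod.smul_fst, Prod.smul_snd,
    smul_eq_mul] at h
  refine (mul_eq_zero.1 (h.trans ?_)).resolve_left two_ne_zero
  ring

theorem area_map (ρ : Plane → Plane) (s : Cycle Plane) :
    area (s.map ρ) = cycleSum (fun v w => triangleArea 0 (ρ v) (ρ w)) s := by
  induction s using Quotient.inductionOn with
  | h l =>
    change listArea (l.map ρ) = (List.zipWith _ l (l.rotate 1)).sum
    rw [listArea, ← List.map_rotate, List.zipWith_map]

/-- For `a` on the line, collinearity gives `triangleArea 0 v w = triangleArea 0 a w - triangleArea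
0 a v`, so the edge sum telescopes. -/
theorem area_eq_zero_of_isTotallyDegenerate {s : Cycle Plane} (hs : IsTotallyDegenerate s) :
    area s = 0 := by
  change cycleSum (triangleArea 0) s = 0
  by_cases h : ∃ a, a ∈ s
  · obtain ⟨a, ha⟩ := h
    refine cycleSum_eq_zero_of_eq_sub (triangleArea 0 a) fun v hv w hw => ?_
    have h1 := triangleArea_eq_zero_of_collinear hs ha hv hw
    simp only [triangleArea, Matrix.det_fin_three, Matrix.of_apply, Matrix.cons_val, Prod.fst_zero,
      Prod.snd_zero] at h1 ⊢
    linear_combination h1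
  · exact cycleSum_eq_zero_of_eq_sub 0 fun v hv => absurd ⟨v, hv⟩ h

theorem IsParallelogram.map_add_eq {ρ : Plane → Plane} {p q r s : Plane}
    (h : IsParallelogram (Cycle.map ρ ([p, q, r, s] : Cycle Plane))) :
    ρ p + ρ r = ρ q + ρ s := by
  obtain ⟨p', q', r', s', h, hadd⟩ := h
  obtain ⟨n, hn, h⟩ := List.isRotated_iff_mod.1 (Cycle.coe_eq_coe.1 h.symm)
  simp only [List.length_cons, List.length_nil] at hn
  interval_cases n <;> simp at h <;> obtain ⟨h1, h2, h3, h4⟩ := h <;> rw [← h1, ← h2, ← h3, ← h4]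
  · exact hadd
  · rw [← hadd, add_comm]
  · rw [add_comm, hadd, add_comm]
  · rw [add_comm s', hadd, add_comm]
  · exact hadd

theorem Cycle.map_id {α : Type*} (s : Cycle α) : s.map id = s := by
  induction s using Quotient.inductionOn with
  | h l => exact congrArg _ (List.map_id l)

namespace GeneralizedDissection

variable {b : Cycle Plane} (D : GeneralizedDissection b)

open Classical in
theorem nodup_and_length {P : Cycle Plane} (hP : P ∈ D.triangles ∪ D.constraints) :
    P.Nodup ∧ 2 ≤ P.length := by
  obtain hP | hP := Finset.mem_union.1 hP
  · have h := (D.isTriangle P hP).1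
    exact ⟨h.1, by rw [h.2]; norm_num⟩
  · have h := (D.isConstraint P hP).1
    exact ⟨h.1, le_trans (by norm_num) h.2⟩

/-- The areas of the triangles of a deformed dissection add up to the area of its boundary. -/
theorem sum_area_map (hb : IsPolygon b) {ρ : Plane → Plane}
    (hρ : ∀ c ∈ D.constraints, IsTotallyDegenerate (c.map ρ)) :
    ∑ t ∈ D.triangles, area (t.map ρ) = area (b.map ρ) := by
  classical
  have hdisj : Disjoint D.triangles D.constraints := Finset.disjoint_left.2 fun t ht hc =>
    (D.isTriangle t ht).2 (D.isConstraint t hc).2.1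
  have h := sum_cycleSum_eq_cycleSum_boundary (fun P => D.nodup_and_length)
    ⟨hb.1, le_trans (by norm_num) hb.2⟩ D.isOrientedDisk.edge_unique
    D.isOrientedDisk.edge_boundary (g := fun v w => triangleArea 0 (ρ v) (ρ w)) (by
      intro v w
      simp only [triangleArea, Matrix.det_fin_three, Matrix.of_apply, Matrix.cons_val,
        Prod.fst_zero, Prod.snd_zero]
      ring)
  simp only [← area_map] at h
  rw [← h, Finset.sum_union hdisj, left_eq_add]
  exact Finset.sum_eq_zero fun c hc => area_eq_zero_of_isTotallyDegenerate (hρ c hc)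

theorem isDeformation_id (hpar : IsParallelogram b) : D.IsDeformation id where
  constraint c hc := by rw [Cycle.map_id]; exact (D.isConstraint c hc).2.1
  boundary := by rwa [Cycle.map_id]

end GeneralizedDissection

/-- The three vertices found by the colouring come in the order of their colours, which may disagree
with the orientation of the triangle. -/
theorem coordDet_eq_or_eq_neg {α K : Type*} [CommRing K] (x y : α → K) {a b c u v w : α}
    (hu : u ∈ [a, b, c]) (hv : v ∈ [a, b, c]) (hw : w ∈ [a, b, c]) (huv : u ≠ v) (hvw : v ≠ w)
    (huw : u ≠ w) :
    coordDet x y u v w = coordDet x y a b c ∨ coordDet x y u v w = -coordDet x y a b c := by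
  simp only [List.mem_cons, List.not_mem_nil, or_false] at hu hv hw
  rcases hu with rfl | rfl | rfl <;> rcases hv with rfl | rfl | rfl <;>
    rcases hw with rfl | rfl | rfl <;>
    first
    | contradiction
    | (left; unfold coordDet; ring1)
    | (right; unfold coordDet; ring1)

theorem IsTriangle.exists_eq {t : Cycle Plane} (ht : IsTriangle t) :
    ∃ a b c : Plane, t = ([a, b, c] : Cycle Plane) := by
  induction t using Quotient.inductionOn with
  | h l =>
    obtain ⟨a, b, c, rfl⟩ := List.length_eq_three.1 ht.2
    exact ⟨a, b, c, rfl⟩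

/-! ### The ring of functions on the deformations -/

namespace GeneralizedDissection

variable {b : Cycle Plane} (D : GeneralizedDissection b)

/-- The areas of the triangles as functions on the set of deformations. -/
noncomputable def areaFunction (t : {t : Cycle Plane // t ∈ D.triangles}) :
    {ρ : Plane → Plane // D.IsDeformation ρ} → ℂ :=
  fun ρ => area (t.1.map ρ.1)

theorem sum_areaFunction (hb : IsPolygon b) :
    ∑ t, D.areaFunction t = fun ρ => area (b.map ρ.1) := by
  funext ρ
  rw [Finset.sum_apply, ← D.sum_area_map hb ρ.2.constraint]
  exact D.triangles.sum_coe_sort fun t => area (t.map ρ.1)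

theorem aeval_areaFunction (f : MvPolynomial {t : Cycle Plane // t ∈ D.triangles} ℤ)
    (ρ : {ρ : Plane → Plane // D.IsDeformation ρ}) :
    MvPolynomial.aeval D.areaFunction f ρ =
      MvPolynomial.aeval (fun t : {t : Cycle Plane // t ∈ D.triangles} => area (t.1.map ρ.1)) f :=
  MvPolynomial.comp_aeval_apply D.areaFunction (Pi.evalAlgHom ℤ (fun _ => ℂ) ρ) f

/-- No place of the functions on the deformations is finite at the areas of the triangles, zero at
`2` and nonzero at the area of the boundary. -/
theorem not_valuation_lt_one (hb : IsPolygon b) (hpar : IsParallelogram b) {K : Type} [Field K]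
    (V : ValuationSubring K) (φ : ({ρ : Plane → Plane // D.IsDeformation ρ} → ℂ) →+* K)
    (harea : ∀ t, V.valuation (φ (D.areaFunction t)) ≤ 1)
    (hbdry : V.valuation (φ fun ρ => area (b.map ρ.1)) = 1) : ¬ V.valuation (φ 2) < 1 := by
  intro htwo
  obtain ⟨p, q, r, s, rfl, -⟩ := hpar
  have hsum (ρ : {ρ : Plane → Plane // D.IsDeformation ρ}) : ρ.1 p + ρ.1 r = ρ.1 q + ρ.1 s :=
    ρ.2.boundary.map_add_eq
  -- The universal drawing: each vertex is sent to the images in `K` of its two coordinate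
  -- functions.
  let x : Plane → K := fun v => φ fun ρ => (ρ.1 v).1
  let y : Plane → K := fun v => φ fun ρ => (ρ.1 v).2
  have hcoord (u v w : Plane) :
      coordDet x y u v w = φ fun ρ => 2 * triangleArea (ρ.1 u) (ρ.1 v) (ρ.1 w) := by
    simp only [coordDet, x, y, ← map_sub, ← map_mul]
    congr 1
    funext ρ
    exact (two_mul_triangleArea _ _ _).symm
  obtain ⟨P, hP, u, v, w, hu, hv, hw, huv, hvw, huw, h⟩ :=
    exists_one_le_valuation_coordDet V x y (fun P => D.nodup_and_length) hb.1
      D.isOrientedDisk.edge_unique D.isOrientedDisk.edge_boundary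
      (by
        simp only [x, ← map_add]
        exact congrArg φ (funext fun ρ => congrArg Prod.fst (hsum ρ)))
      (by
        simp only [y, ← map_add]
        exact congrArg φ (funext fun ρ => congrArg Prod.snd (hsum ρ)))
      (by
        rw [hcoord, ← hbdry]
        congr 2
        funext ρ
        rw [two_mul_triangleArea]
        exact (area_parallelogram _ _ _ _ (hsum ρ)).symm)
  refine h.not_gt ?_
  obtain hP | hP := Finset.mem_union.1 hP
  · obtain ⟨a, b', c, rfl⟩ := (D.isTriangle P hP).1.exists_eq
    have hval : V.valuation (coordDet x y a b' c) < 1 := by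
      have : (fun ρ : {ρ : Plane → Plane // D.IsDeformation ρ} =>
          2 * triangleArea (ρ.1 a) (ρ.1 b') (ρ.1 c)) = 2 * D.areaFunction ⟨_, hP⟩ := by
        funext ρ
        exact congrArg (2 * ·) (area_triangle _ _ _).symm
      rw [hcoord, this, map_mul, map_mul]
      exact mul_lt_one_of_lt_of_le htwo (harea _)
    obtain e | e := coordDet_eq_or_eq_neg x y hu hv hw huv hvw huw
    · rwa [e]
    · rwa [e, Valuation.map_neg]
  · have h0 : (fun ρ : {ρ : Plane → Plane // D.IsDeformation ρ} =>
        2 * triangleArea (ρ.1 u) (ρ.1 v) (ρ.1 w)) = 0 := by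
      funext ρ
      have hmem {v : Plane} (hv : v ∈ P) : ρ.1 v ∈ {v | v ∈ P.map ρ.1} :=
        Cycle.mem_map.2 ⟨v, hv, rfl⟩
      rw [triangleArea_eq_zero_of_collinear (ρ.2.constraint P hP) (hmem hu) (hmem hv) (hmem hw),
        mul_zero]
      rfl
    rw [hcoord, h0, map_zero, map_zero]
    exact zero_lt_one

end GeneralizedDissection

theorem mainTheorem5 (b : Cycle Plane) (hb : IsPolygon b) (hpar : IsParallelogram b)
    (D : GeneralizedDissection b) :
    ∃ (f : MvPolynomial {t : Cycle Plane // t ∈ D.triangles} ℤ) (e : ℕ),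
      MvPolynomial.aeval (fun t : {t : Cycle Plane // t ∈ D.triangles} => area t.1) f
          = 1 / 2 * area b ^ e ∧
      ∀ ρ : Plane → Plane, D.IsDeformation ρ →
        MvPolynomial.aeval
            (fun t : {t : Cycle Plane // t ∈ D.triangles} => area (t.1.map ρ)) f
          = 1 / 2 * area (b.map ρ) ^ e := by
  obtain ⟨f, e, hfe⟩ : ∃ (f : MvPolynomial {t : Cycle Plane // t ∈ D.triangles} ℤ) (e : ℕ),
      -- An identity between functions on the deformations, so the choice of `f` and `e` precedes
      -- that of `ρ`.
      2 * MvPolynomial.aeval D.areaFunction f = (∑ t, D.areaFunction t) ^ e := by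
    by_contra! hne
    let A := (MvPolynomial.aeval (R := ℤ) D.areaFunction).range
    let a (t : {t : Cycle Plane // t ∈ D.triangles}) : A :=
      ⟨D.areaFunction t, MvPolynomial.X t, MvPolynomial.aeval_X _ t⟩
    have htwo : A.val 2 = 2 := map_ofNat A.val 2
    obtain ⟨K, _, V, φ, hA, h2, hsum⟩ := exists_valuationSubring_of_mul_ne_pow
      A.val.toRingHom Subtype.val_injective 2 (∑ t, a t) (by
        rintro ⟨_, f, rfl⟩ e h
        refine hne f e ?_
        have h' := congrArg A.val h
        rw [map_mul, htwo, map_pow, map_sum] at h'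
        exact h')
    refine D.not_valuation_lt_one hb hpar V φ (fun t => hA (a t)) ?_ 
      (lt_of_eq_of_lt (congrArg (fun z => V.valuation (φ z)) htwo.symm) h2)
    rw [← D.sum_areaFunction hb, ← hsum]
    congr 2
    simp [a]
  have hmain (ρ : Plane → Plane) (hρ : D.IsDeformation ρ) :
      MvPolynomial.aeval (fun t : {t : Cycle Plane // t ∈ D.triangles} => area (t.1.map ρ)) f
        = 1 / 2 * area (b.map ρ) ^ e := by
    have h := congrFun hfe ⟨ρ, hρ⟩
    rw [D.sum_areaFunction hb, Pi.mul_apply, Pi.pow_apply, D.aeval_areaFunction] at h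
    rw [← h]
    simp only [Pi.ofNat_apply]
    ring
  refine ⟨f, e, ?_, hmain⟩
  -- The dissection itself is the identity deformation.
  simpa only [Cycle.map_id] using hmain id (D.isDeformation_id hpar)
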